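/- Let $D_n$ be the $n$-th Weyl algebra over $\mathbb{C}$, let $\mathbb{C}[s]=\mathbb{C}[s_1,\dots,s_p]$, and let $D_n[s]=D_n[s_1,\dots,s_p]$ be the polynomial ring over $D_n$ in the central variables $s_1,\dots,s_p$. For $\alpha\in\mathbb{C}^p$ let $\mathfrak{m}_\alpha\subset\mathbb{C}[s]$ be the maximal ideal of polynomials vanishing at $\alpha$, and for an ideal $I$ or a polynomial $h$ of $\mathbb{C}[s]$ let $Z(I)$, $Z(h)\subseteq\mathbb{C}^p$ be its zero set. Let $\mathfrak{J}\subseteq D_n[s]$ be a left ideal. Then, for every minimal prime divisor $\mathfrak{p}$ of $\mathfrak{J}\cap\mathbb{C}[s]$, there is a polynomial $h\in\mathbb{C}[s]\setminus\mathfrak{p}$ such that for all $\alpha\in Z(\mathfrak{p})\setminus Z(h)$ $$\left(D_n[s]/\mathfrak{J}\right)\otimes_{\mathbb{C}[s]}\left(\mathbb{C}[s]/\mathfrak{m}_\alpha\right)\neq 0.$$ Consequently, the set of all $\alpha\in\mathbb{C}^p$ at which this tensor product is nonzero is contained in $Z(\operatorname{Ann}_{\mathbb{C}[s]}(D_n[s]/\mathfrak{J}))$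 and contains a Zariski open and Zariski dense subset of it. -/

import Mathlib

open scoped TensorProduct

noncomputable section

/-- The `n`-th Weyl algebra `D_n` over `ℂ`: the algebra of polynomial differential operators, i.e.
the `ℂ`-subalgebra of `End_ℂ(ℂ[x_1, …, x_n])` generated by the multiplication operators `x_i` and
the partial derivatives `∂_i`. -/
def WeylAlgebra (n : ℕ) : Subalgebra ℂ (Module.End ℂ (MvPolynomial (Fin n) ℂ)) :=
  Algebra.adjoin ℂ
    (Set.range (fun i : Fin n => LinearMap.mulLeft ℂ (MvPolynomial.X i : MvPolynomial (Fin n) ℂ)) ∪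
      Set.range (fun i : Fin n =>
        (MvPolynomial.pderiv i : Derivation ℂ (MvPolynomial (Fin n) ℂ) _).toLinearMap))

/-- The commutative polynomial ring `ℂ[s_1, …, s_p]`. -/
abbrev ParamRing (p : ℕ) : Type := MvPolynomial (Fin p) ℂ

/-- The ring `D_n[s_1, …, s_p] = ℂ[s_1, …, s_p] ⊗_ℂ D_n` of polynomials in the central variables
`s_1, …, s_p` with coefficients in the Weyl algebra. It is an algebra over `ℂ[s_1, …, s_p]`
through `f ↦ f ⊗ 1`. -/
def RelWeylAlgebra (n p : ℕ) : Type := ParamRing p ⊗[ℂ] WeylAlgebra n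

instance (n p : ℕ) : Ring (RelWeylAlgebra n p) :=
  inferInstanceAs (Ring (ParamRing p ⊗[ℂ] WeylAlgebra n))

instance (n p : ℕ) : Algebra (ParamRing p) (RelWeylAlgebra n p) :=
  Algebra.TensorProduct.leftAlgebra (R := ℂ) (S := ParamRing p) (A := ParamRing p)
    (B := WeylAlgebra n)

/-- The maximal ideal `𝔪_α` of `ℂ[s_1, …, s_p]`: all polynomials that vanish at `α`. -/
def maximalIdealAt {p : ℕ} (α : Fin p → ℂ) : Ideal (ParamRing p) :=
  RingHom.ker (MvPolynomial.eval α)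

/-- The specialization `(D_n[s] / 𝔍) ⊗_{ℂ[s]} (ℂ[s] / 𝔪_α)` at `α`, for a left ideal `𝔍`
of `D_n[s]` (`Ideal` means left ideal over a noncommutative ring). -/
abbrev SpecializationAt {n p : ℕ} (J : Ideal (RelWeylAlgebra n p)) (α : Fin p → ℂ) : Type :=
  (RelWeylAlgebra n p ⧸ J) ⊗[ParamRing p] (ParamRing p ⧸ maximalIdealAt α)

/-- The support of `D_n[s] / 𝔍` in `ℂ^p`: the points at which the specialization is nonzero. -/
def specializationSupport {n p : ℕ} (J : Ideal (RelWeylAlgebra n p)) : Set (Fin p → ℂ) :=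
  {α | Nontrivial (SpecializationAt J α)}

/-- The zero set in `ℂ^p` of the annihilator of `D_n[s] / 𝔍` in `ℂ[s]`. -/
def annihilatorZeroSet {n p : ℕ} (J : Ideal (RelWeylAlgebra n p)) : Set (Fin p → ℂ) :=
  MvPolynomial.zeroLocus ℂ (Module.annihilator (ParamRing p) (RelWeylAlgebra n p ⧸ J))

/-- `U` is a relatively Zariski open subset of `Z ⊆ ℂ^p`. -/
def IsZariskiOpenIn {p : ℕ} (U Z : Set (Fin p → ℂ)) : Prop :=
  ∃ I : Ideal (ParamRing p), U = Z \ MvPolynomial.zeroLocus ℂ I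

/-- `U ⊆ Z` is Zariski dense in `Z ⊆ ℂ^p`: every Zariski closed set that contains `U`
contains `Z`. -/
def IsZariskiDenseIn {p : ℕ} (U Z : Set (Fin p → ℂ)) : Prop :=
  U ⊆ Z ∧ ∀ I : Ideal (ParamRing p),
    U ⊆ MvPolynomial.zeroLocus ℂ I → Z ⊆ MvPolynomial.zeroLocus ℂ I

end

/-! Write `R = ℂ[s]`. `D_n[s]` is free over `R` on the monomials `x^a ∂^b`, so elements of `J`
become coefficient families over `R`, ordered by a monomial order. Multiplying by `x_i` or `∂_i`
shifts leading exponents and preserves leading coefficients modulo `P`. By Dickson's lemma finitely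
many elements of `J` account for all leading exponents modulo `P`; take `h` to be the product of
their leading coefficients. Where `h ≠ 0`, division by these elements specializes well
(`IsShiftStableMod.exists_specialization`).

If the specialization at such an `α ∈ Z(P)` were zero, some `f ∈ J` would be congruent to `1` modulo
`𝔪_α`. Its only nonzero specialized coefficient sits at exponent `0`, so `0` is a leading exponent
modulo `P`: some `g ∈ J` is congruent modulo `P` to a constant `a ∉ P`. Hence `a • 1` lies in `P •
(D_n[s] / J)`, which `Ideal.smul_mk_one_notMem_smul_top_of_mem_minimalPrimes` excludes: a power of
`P` falls into `J ∩ R` after localizing at `P`.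

The support statement follows because the annihilator is `J ∩ R`; the open sets on the components
are glued by `MvPolynomial.exists_dense_sdiff_zeroLocus`. -/

theorem Finsupp.nat_induction_single_one_add {σ : Type*} {p : (σ →₀ ℕ) → Prop} (zero : p 0)
    (single_one_add : ∀ i a, p a → p (Finsupp.single i 1 + a)) (a : σ →₀ ℕ) : p a := by
  induction a using Finsupp.induction with
  | zero => exact zero
  | single_add i k f _ _ ih =>
    clear * - single_one_add ih
    induction k with
    | zero => simpa using ih
    | succ k hk =>
      rw [add_comm k 1, Finsupp.single_add, add_assoc]
      exact single_one_add i _ hk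

/-! ### Leading exponents modulo a prime and generic division -/

namespace MonomialOrder

variable {σ R : Type*} [CommRing R] (m : MonomialOrder σ)

theorem nonempty_of_finite.{u} (σ : Type u) [Finite σ] : Nonempty (MonomialOrder.{u, u} σ) := by
  obtain ⟨k, ⟨e⟩⟩ := Finite.exists_equiv_fin σ
  let : LinearOrder σ := LinearOrder.lift' e e.injective
  exact ⟨MonomialOrder.lex⟩

/-- The exponent `γ` is the leading exponent of `f` modulo the ideal `P`. -/
def IsLeadingExponentMod (P : Ideal R) (f : (σ →₀ ℕ) →₀ R) (γ : σ →₀ ℕ) : Prop :=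
  f γ ∉ P ∧ ∀ δ, m.toSyn γ < m.toSyn δ → f δ ∈ P

/-- A coefficient family with a coefficient outside `P` has a leading exponent modulo `P`. -/
theorem exists_isLeadingExponentMod (P : Ideal R) (f : (σ →₀ ℕ) →₀ R) (hf : ∃ γ, f γ ∉ P) :
    ∃ γ, m.IsLeadingExponentMod P f γ := by
  classical
  obtain ⟨γ₀, hγ₀⟩ := hf
  have mem_support : ∀ γ, f γ ∉ P → γ ∈ f.support.filter (fun γ => f γ ∉ P) := fun γ hγ =>
    Finset.mem_filter.2 ⟨Finsupp.mem_support_iff.2 fun h => hγ (h ▸ P.zero_mem), hγ⟩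
  obtain ⟨γ, hγ, hmax⟩ := Finset.exists_max_image (f.support.filter (fun γ => f γ ∉ P)) m.toSyn
    ⟨γ₀, mem_support γ₀ hγ₀⟩
  refine ⟨γ, (Finset.mem_filter.1 hγ).2, fun δ hδ => ?_⟩
  by_contra h
  exact absurd (hmax δ (mem_support δ h)) (not_le.2 hδ)

/-- The set of leading exponents modulo `P` of the elements of `N`. -/
def leadingExponentsMod (P : Ideal R) (N : Submodule R ((σ →₀ ℕ) →₀ R)) : Set (σ →₀ ℕ) :=
  {γ | ∃ g ∈ N, m.IsLeadingExponentMod P g γ}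

/-- `N` is stable under raising the leading exponent modulo `P` by one in each variable, with the
leading coefficient unchanged modulo `P`. -/
def IsShiftStableMod (P : Ideal R) (N : Submodule R ((σ →₀ ℕ) →₀ R)) : Prop :=
  ∀ g ∈ N, ∀ (i : σ) (γ : σ →₀ ℕ), (∀ δ, m.toSyn γ < m.toSyn δ → g δ ∈ P) →
    ∃ g' ∈ N, g' (Finsupp.single i 1 + γ) - g γ ∈ P ∧
      ∀ δ, m.toSyn (Finsupp.single i 1 + γ) < m.toSyn δ → g' δ ∈ P

variable {m}

theorem IsShiftStableMod.exists_shift {P : Ideal R} {N : Submodule R ((σ →₀ ℕ) →₀ R)}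
    (hN : m.IsShiftStableMod P N) (κ : σ →₀ ℕ) :
    ∀ g ∈ N, ∀ γ : σ →₀ ℕ, (∀ δ, m.toSyn γ < m.toSyn δ → g δ ∈ P) →
      ∃ g' ∈ N, g' (κ + γ) - g γ ∈ P ∧ ∀ δ, m.toSyn (κ + γ) < m.toSyn δ → g' δ ∈ P := by
  intro g hg γ hγ
  induction κ using Finsupp.nat_induction_single_one_add with
  | zero => exact ⟨g, hg, by simp, by simpa using hγ⟩
  | single_one_add i κ ih =>
    obtain ⟨g₁, hg₁, hc₁, hl₁⟩ := ih
    obtain ⟨g₂, hg₂, hc₂, hl₂⟩ := hN g₁ hg₁ i _ hl₁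
    rw [← add_assoc] at hc₂ hl₂
    exact ⟨g₂, hg₂, by simpa using P.add_mem hc₂ hc₁, hl₂⟩

/-- Generic specialization: outside the zero locus of a suitable `h ∉ P`, a specialization of an
element of `N` is zero or has a nonzero coefficient at a leading exponent modulo `P` of `N`. -/
theorem IsShiftStableMod.exists_specialization [Finite σ] {P : Ideal R} (hP : P.IsPrime)
    {N : Submodule R ((σ →₀ ℕ) →₀ R)} (hN : m.IsShiftStableMod P N) :
    ∃ h ∉ P, ∀ {k : Type} [Field k] (φ : R →+* k), (∀ a ∈ P, φ a = 0) → φ h ≠ 0 → ∀ f ∈ N,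
      (∀ γ, φ (f γ) = 0) ∨ ∃ γ ∈ m.leadingExponentsMod P N, φ (f γ) ≠ 0 := by
  classical
  -- Dickson's lemma: an antichain of exponents in finitely many variables is finite.
  have hfin : {γ | Minimal (· ∈ m.leadingExponentsMod P N) γ}.Finite :=
    WellQuasiOrderedLE.finite_of_isAntichain (setOfPred_minimal_antichain _)
  choose! G hGN hG using fun γ (hγ : γ ∈ m.leadingExponentsMod P N) => hγ
  refine ⟨∏ γ ∈ hfin.toFinset, G γ γ, ?_, ?_⟩
  · rw [hP.prod_mem_iff]
    rintro ⟨γ, hγ, hmem⟩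
    exact (hG γ ((hfin.mem_toFinset.1 hγ).1)).1 hmem
  intro k _ φ hφ hh
  have key : ∀ γ, ∀ f ∈ N, m.IsLeadingExponentMod P f (m.toSyn.symm γ) →
      (∀ γ, φ (f γ) = 0) ∨ ∃ γ ∈ m.leadingExponentsMod P N, φ (f γ) ≠ 0 := by
    intro γ
    induction γ using WellFoundedLT.induction with
    | ind γ ih =>
    intro f hf hfγ
    set ε := m.toSyn.symm γ with hε
    by_cases hlc : φ (f ε) ≠ 0
    · exact Or.inr ⟨ε, ⟨f, hf, hfγ⟩, hlc⟩
    rw [not_not] at hlc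
    obtain ⟨β, hβε, hβ⟩ := exists_minimal_le_of_wellFoundedLT (· ∈ m.leadingExponentsMod P N) ε
      ⟨f, hf, hfγ⟩
    have hc : φ (G β β) ≠ 0 := by
      rw [map_prod, Finset.prod_ne_zero_iff] at hh
      exact hh β (hfin.mem_toFinset.2 hβ)
    obtain ⟨g', hg', hgc, hgl⟩ := hN.exists_shift (ε - β) (G β) (hGN β hβ.1) β (hG β hβ.1).2
    rw [tsub_add_cancel_of_le hβε] at hgc hgl
    -- Division step: the leading term cancels modulo `P`. As `φ (f ε) = 0`, the specialization of
    -- `f'` is that of `f` times the nonzero scalar `φ (G β β)`.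
    set f' := G β β • f - f ε • g' with hf'
    have hf'N : f' ∈ N := N.sub_mem (N.smul_mem _ hf) (N.smul_mem _ hg')
    have hφ' : ∀ δ, φ (f' δ) = φ (G β β) * φ (f δ) := by intro δ; simp [hf', hlc]
    have concl : (∀ γ, φ (f' γ) = 0) ∨ ∃ γ ∈ m.leadingExponentsMod P N, φ (f' γ) ≠ 0 := by
      by_cases hall : ∃ δ, f' δ ∉ P
      · obtain ⟨ε', hε'⟩ := m.exists_isLeadingExponentMod P f' hall
        refine ih (m.toSyn ε') ?_ f' hf'N (by simpa using hε')
        by_contra hlt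
        rw [not_lt] at hlt
        refine hε'.1 ?_
        rcases hlt.eq_or_lt with heq | hlt
        · have : ε' = ε := by rw [hε, heq]; simp
          have hval : f' ε = -(f ε * (g' ε - G β β)) := by simp [hf']; ring
          rw [this, hval]
          exact P.neg_mem (P.mul_mem_left _ hgc)
        · have hlt' : m.toSyn ε < m.toSyn ε' := by simpa [hε] using hlt
          have : f' ε' = G β β * f ε' - f ε * g' ε' := by simp [hf']
          rw [this]
          exact P.sub_mem (P.mul_mem_left _ (hfγ.2 _ hlt')) (P.mul_mem_left _ (hgl _ hlt'))
      · push Not at hall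
        exact Or.inl fun γ => hφ _ (hall γ)
    refine concl.imp (fun h δ => ?_) (fun ⟨δ, hδ, hne⟩ => ⟨δ, hδ, fun h0 => hne ?_⟩)
    · have := h δ
      rw [hφ', mul_eq_zero] at this
      exact this.resolve_left hc
    · rw [hφ', h0, mul_zero]
  intro f hf
  by_cases hall : ∃ δ, f δ ∉ P
  · obtain ⟨ε, hε⟩ := m.exists_isLeadingExponentMod P f hall
    exact key (m.toSyn ε) f hf (by simpa using hε)
  · push Not at hall
    exact Or.inl fun γ => hφ _ (hall γ)

end MonomialOrder

/-! ### The normally ordered basis of the Weyl algebra -/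

noncomputable section

namespace WeylAlgebra

open MvPolynomial

variable {n : ℕ}

/-- The iterated partial derivative `∂^b`. -/
def iteratedPDeriv (b : Fin n →₀ ℕ) : Module.End ℂ (MvPolynomial (Fin n) ℂ) :=
  (basisMonomials (Fin n) ℂ).constr ℂ fun c =>
    monomial (c - b) (∏ i, ((c i).descFactorial (b i) : ℂ))

theorem iteratedPDeriv_monomial (b c : Fin n →₀ ℕ) :
    iteratedPDeriv b (monomial c 1) = monomial (c - b) (∏ i, ((c i).descFactorial (b i) : ℂ)) := by
  have := (basisMonomials (Fin n) ℂ).constr_basis ℂ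
    (fun c => monomial (c - b) (∏ i, ((c i).descFactorial (b i) : ℂ))) c
  rwa [coe_basisMonomials] at this

/-- The operator of multiplication by the variable `x_i`. -/
abbrev mulX (i : Fin n) : Module.End ℂ (MvPolynomial (Fin n) ℂ) :=
  LinearMap.mulLeft ℂ (X i)

/-- The partial derivative `∂_i` as an endomorphism. -/
abbrev partialDeriv (i : Fin n) : Module.End ℂ (MvPolynomial (Fin n) ℂ) :=
  (pderiv i : Derivation ℂ (MvPolynomial (Fin n) ℂ) _).toLinearMap

theorem end_ext {f g : Module.End ℂ (MvPolynomial (Fin n) ℂ)}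
    (h : ∀ c, f (monomial c 1) = g (monomial c 1)) : f = g :=
  (basisMonomials (Fin n) ℂ).ext fun c => by simpa [coe_basisMonomials] using h c

theorem iteratedPDeriv_zero : iteratedPDeriv (0 : Fin n →₀ ℕ) = 1 :=
  end_ext fun c => by simp [iteratedPDeriv_monomial]

theorem partialDeriv_mul_iteratedPDeriv (i : Fin n) (b : Fin n →₀ ℕ) :
    partialDeriv i * iteratedPDeriv b = iteratedPDeriv (Finsupp.single i 1 + b) := by
  refine end_ext fun c => ?_
  rw [Module.End.mul_apply, iteratedPDeriv_monomial, iteratedPDeriv_monomial]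
  change pderiv i _ = _
  rw [pderiv_monomial, tsub_tsub, add_comm b]
  congr 1
  rw [← Finset.mul_prod_erase _ _ (Finset.mem_univ i), ← Finset.mul_prod_erase _ _
    (Finset.mem_univ i), mul_right_comm]
  congr 1
  · simp [add_comm 1 (b i), Nat.descFactorial_succ, mul_comm]
  · refine Finset.prod_congr rfl fun j hj => ?_
    simp [(Finset.ne_of_mem_erase hj).symm]

/-- The normally ordered monomial `x^a ∂^b`. -/
def normalMonomial (ab : (Fin n →₀ ℕ) × (Fin n →₀ ℕ)) : Module.End ℂ (MvPolynomial (Fin n) ℂ) :=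
  LinearMap.mulLeft ℂ (monomial ab.1 1) * iteratedPDeriv ab.2

theorem normalMonomial_apply_monomial (a b c : Fin n →₀ ℕ) :
    normalMonomial (a, b) (monomial c 1) =
      monomial (a + (c - b)) (∏ i, ((c i).descFactorial (b i) : ℂ)) := by
  simp [normalMonomial, iteratedPDeriv_monomial, monomial_mul]

theorem mulX_mul_normalMonomial (i : Fin n) (a b : Fin n →₀ ℕ) :
    mulX i * normalMonomial (a, b) = normalMonomial (Finsupp.single i 1 + a, b) := by
  rw [normalMonomial, normalMonomial, ← mul_assoc]
  congr 1
  refine LinearMap.ext fun f => ?_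
  simp [X, monomial_mul, ← mul_assoc]

/-- This is the Leibniz rule. If `a i = 0`, the truncated subtraction is harmless because its
coefficient vanishes. -/
theorem partialDeriv_mul_normalMonomial (i : Fin n) (a b : Fin n →₀ ℕ) :
    partialDeriv i * normalMonomial (a, b) = normalMonomial (a, Finsupp.single i 1 + b) +
      (a i : ℂ) • normalMonomial (a - Finsupp.single i 1, b) := by
  rw [normalMonomial, normalMonomial, normalMonomial, ← partialDeriv_mul_iteratedPDeriv]
  refine LinearMap.ext fun f => ?_
  have h : (monomial (a - Finsupp.single i 1) (a i : ℂ) : MvPolynomial (Fin n) ℂ) =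
      (a i : ℂ) • monomial (a - Finsupp.single i 1) 1 := by simp [smul_monomial]
  simp [Derivation.leibniz, pderiv_monomial, h, mul_comm]

theorem normalMonomial_zero : normalMonomial (0 : (Fin n →₀ ℕ) × (Fin n →₀ ℕ)) = 1 := by
  refine LinearMap.ext fun f => ?_
  simp [normalMonomial, iteratedPDeriv_zero]

/-- In a relation, pick `b₀` of least degree among the `∂`-exponents and apply it to `x^b₀`. Every
other `∂^b` in the relation kills `x^b₀`, and the remaining terms are multiples of distinct
monomials `x^a`. -/
theorem linearIndependent_normalMonomial :
    LinearIndependent ℂ (normalMonomial : (Fin n →₀ ℕ) × (Fin n →₀ ℕ) → _) := by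
  rw [linearIndependent_iff]
  intro l hl
  by_contra hne
  obtain ⟨⟨a₀, b₀⟩, hmem, hmin⟩ := Finset.exists_min_image l.support
    (fun ab => ab.2.degree) (Finsupp.support_nonempty_iff.2 hne)
  have h := congrArg (coeff a₀) (LinearMap.congr_fun hl (monomial b₀ 1))
  rw [Finsupp.linearCombination_apply, Finsupp.sum, LinearMap.sum_apply, coeff_sum,
    Finset.sum_eq_single (a₀, b₀)] at h
  · rw [LinearMap.smul_apply, normalMonomial_apply_monomial, coeff_smul] at h
    simp only [tsub_self, add_zero, coeff_monomial, if_true, LinearMap.zero_apply, coeff_zero,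
      smul_eq_mul, mul_eq_zero, Finset.prod_eq_zero_iff, Nat.descFactorial_self,
      Nat.cast_eq_zero, Nat.factorial_ne_zero, and_false, exists_false, or_false] at h
    exact Finsupp.mem_support_iff.1 hmem h
  · rintro ⟨a, b⟩ hab hne'
    rw [LinearMap.smul_apply, normalMonomial_apply_monomial, coeff_smul, coeff_monomial]
    split_ifs with ha
    · have hle : ¬ b ≤ b₀ := by
        intro hle
        have hb : b = b₀ := by
          by_contra hbne
          have h1 := hmin _ hab
          have h2 : b.degree + (b₀ - b).degree = b₀.degree := by
            rw [← map_add, add_tsub_cancel_of_le hle]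
          have h3 : (b₀ - b).degree = 0 := by simp only at h1; omega
          rw [Finsupp.degree_eq_zero_iff, tsub_eq_zero_iff_le] at h3
          exact hbne (le_antisymm hle h3)
        subst hb
        simp only [tsub_self, add_zero] at ha
        exact hne' (by rw [ha])
      rw [Finsupp.le_def, not_forall] at hle
      obtain ⟨i, hi⟩ := hle
      rw [Finset.prod_eq_zero (Finset.mem_univ i), smul_zero]
      rw [Nat.descFactorial_eq_zero_iff_lt.2 (not_le.1 hi), Nat.cast_zero]
    · exact smul_zero _
  · exact fun h' => absurd hmem h'

theorem mulX_mem (i : Fin n) : mulX i ∈ WeylAlgebra n :=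
  Algebra.subset_adjoin (Or.inl ⟨i, rfl⟩)

theorem partialDeriv_mem (i : Fin n) : partialDeriv i ∈ WeylAlgebra n :=
  Algebra.subset_adjoin (Or.inr ⟨i, rfl⟩)

theorem normalMonomial_mem (ab : (Fin n →₀ ℕ) × (Fin n →₀ ℕ)) :
    normalMonomial ab ∈ WeylAlgebra n := by
  obtain ⟨a, b⟩ := ab
  induction a using Finsupp.nat_induction_single_one_add with
  | zero =>
    induction b using Finsupp.nat_induction_single_one_add with
    | zero => exact normalMonomial_zero (n := n) ▸ one_mem _
    | single_one_add i b ih =>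
      have h := partialDeriv_mul_normalMonomial i 0 b
      rw [Finsupp.coe_zero, Pi.zero_apply, Nat.cast_zero, zero_smul, add_zero] at h
      exact h ▸ mul_mem (partialDeriv_mem i) ih
  | single_one_add i a ih => exact mulX_mul_normalMonomial i a b ▸ mul_mem (mulX_mem i) ih

/-- The span contains `1` and is stable under left multiplication by the generators, hence by the
whole algebra. -/
theorem span_normalMonomial :
    Submodule.span ℂ (Set.range (normalMonomial (n := n))) =
      Subalgebra.toSubmodule (WeylAlgebra n) := by
  refine le_antisymm (Submodule.span_le.2 ?_) fun w hw => ?_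
  · rintro _ ⟨ab, rfl⟩
    exact normalMonomial_mem ab
  set V := Submodule.span ℂ (Set.range (normalMonomial (n := n))) with hV
  have mem (ab) : normalMonomial ab ∈ V := Submodule.subset_span ⟨ab, rfl⟩
  have stable (g : Module.End ℂ (MvPolynomial (Fin n) ℂ)) (hg : ∀ ab, g * normalMonomial ab ∈ V) :
      ∀ v ∈ V, g * v ∈ V := by
    intro v hv
    have : V ≤ V.comap (LinearMap.mulLeft ℂ g) := by
      conv_lhs => rw [hV]
      rw [Submodule.span_le]
      rintro _ ⟨ab, rfl⟩
      exact hg ab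
    exact this hv
  have key : ∀ v ∈ V, w * v ∈ V := by
    induction hw using Algebra.adjoin_induction with
    | mem g hg =>
      rcases hg with ⟨i, rfl⟩ | ⟨i, rfl⟩
      · refine stable _ ?_
        rintro ⟨a, b⟩
        exact mulX_mul_normalMonomial i a b ▸ mem _
      · refine stable _ ?_
        rintro ⟨a, b⟩
        exact partialDeriv_mul_normalMonomial i a b ▸ V.add_mem (mem _) (V.smul_mem _ (mem _))
    | algebraMap r =>
      intro v hv
      rw [← Algebra.smul_def]
      exact V.smul_mem _ hv
    | add x y _ _ hx hy =>
      intro v hv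
      rw [add_mul]
      exact V.add_mem (hx v hv) (hy v hv)
    | mul x y _ _ hx hy =>
      intro v hv
      rw [mul_assoc]
      exact hx _ (hy v hv)
  simpa [normalMonomial_zero] using key 1 (normalMonomial_zero (n := n) ▸ mem 0)

/-- The basis of normally ordered monomials `x^a ∂^b` of the Weyl algebra, indexed by the joint
exponent `(a, b)`. -/
def normalBasis (n : ℕ) : Module.Basis (Fin n ⊕ Fin n →₀ ℕ) ℂ (WeylAlgebra n) :=
  ((Module.Basis.span linearIndependent_normalMonomial).map
    (LinearEquiv.ofEq _ _ span_normalMonomial)).reindex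
      Finsupp.sumFinsuppEquivProdFinsupp.symm

theorem coe_normalBasis (γ : Fin n ⊕ Fin n →₀ ℕ) :
    (normalBasis n γ : Module.End ℂ (MvPolynomial (Fin n) ℂ)) =
      normalMonomial (Finsupp.sumFinsuppEquivProdFinsupp γ) := by
  simp [normalBasis, Module.Basis.span_apply]

theorem normalBasis_zero : normalBasis n 0 = 1 := by
  refine Subtype.ext ?_
  rw [coe_normalBasis]
  have : Finsupp.sumFinsuppEquivProdFinsupp (0 : Fin n ⊕ Fin n →₀ ℕ) = 0 := by
    refine Prod.ext ?_ ?_ <;> ext k <;> simp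
  rw [this, normalMonomial_zero]
  rfl

/-- Left multiplication by `x_i` or `∂_i` raises a normally ordered monomial by one in the
corresponding variable, up to a multiple of a monomial of smaller exponent. -/
theorem exists_mul_normalBasis (j : Fin n ⊕ Fin n) : ∃ w : WeylAlgebra n, ∀ γ, ∃ γ' ≤ γ, ∃ c : ℂ,
    w * normalBasis n γ = normalBasis n (Finsupp.single j 1 + γ) + c • normalBasis n γ' := by
  rcases j with i | i
  · refine ⟨⟨mulX i, mulX_mem i⟩, fun γ => ⟨γ, le_rfl, 0, Subtype.ext ?_⟩⟩
    have := mulX_mul_normalMonomial i (Finsupp.sumFinsuppEquivProdFinsupp γ).1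
      (Finsupp.sumFinsuppEquivProdFinsupp γ).2
    simp only [zero_smul, add_zero, MulMemClass.coe_mul, coe_normalBasis]
    refine this.trans (congrArg _ (Prod.ext ?_ ?_)) <;> ext k <;>
      simp [Finsupp.single_apply]
  · refine ⟨⟨partialDeriv i, partialDeriv_mem i⟩, fun γ => ⟨γ - Finsupp.single (Sum.inl i) 1,
      tsub_le_self, γ (Sum.inl i), Subtype.ext ?_⟩⟩
    have := partialDeriv_mul_normalMonomial i (Finsupp.sumFinsuppEquivProdFinsupp γ).1
      (Finsupp.sumFinsuppEquivProdFinsupp γ).2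
    simp only [MulMemClass.coe_mul, AddMemClass.coe_add, SetLike.val_smul, coe_normalBasis]
    refine this.trans ?_
    congr 2
    · refine Prod.ext ?_ ?_ <;> ext k <;> simp [Finsupp.single_apply]
    · congr 1
      refine Prod.ext ?_ ?_ <;> ext k <;> simp [Finsupp.single_apply]

end WeylAlgebra

end

/-! ### Cyclic modules over an algebra and minimal primes -/

section AlgebraQuotient

variable {R D : Type*} [CommRing R] [Ring D] [Algebra R D]

/-- Scalars are central, so one that kills the class of `1` kills every class, although `J` is only
a left ideal. -/
theorem Ideal.annihilator_quotient_eq_comap_algebraMap (J : Ideal D) :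
    Module.annihilator R (D ⧸ J) = J.comap (algebraMap R D) := by
  ext r
  rw [Module.mem_annihilator, Ideal.mem_comap]
  constructor
  · intro h
    have h1 := h (Submodule.Quotient.mk 1)
    rwa [← Submodule.Quotient.mk_smul, Submodule.Quotient.mk_eq_zero, ← Algebra.algebraMap_eq_smul_one] at h1
  · intro h m
    obtain ⟨d, rfl⟩ := Submodule.Quotient.mk_surjective J m
    rw [← Submodule.Quotient.mk_smul, Submodule.Quotient.mk_eq_zero, Algebra.smul_def,
      Algebra.commutes]
    exact J.smul_mem d h

/-- In a Noetherian ring, some power of a minimal prime over `I` becomes contained in `I` after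
localization at that prime. -/
theorem Ideal.exists_pow_forall_exists_mul_mem_of_mem_minimalPrimes [IsNoetherianRing R]
    {I P : Ideal R} (hP : P ∈ I.minimalPrimes) :
    ∃ k : ℕ, ∀ r ∈ P ^ k, ∃ s ∉ P, s * r ∈ I := by
  have := hP.isPrime
  have hle : P ≤ ((I.map (algebraMap R (Localization.AtPrime P))).comap
      (algebraMap R (Localization.AtPrime P))).radical := by
    rw [← Ideal.comap_radical, ← Ideal.map_le_iff_le_comap,
      IsLocalization.AtPrime.radical_map_of_mem_minimalPrimes _ P I hP]
  obtain ⟨k, hk⟩ := Ideal.exists_pow_le_of_le_radical_of_fg hle (IsNoetherian.noetherian P)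
  refine ⟨k, fun r hr => ?_⟩
  have h := hk hr
  rw [Ideal.mem_comap, IsLocalization.algebraMap_mem_map_algebraMap_iff P.primeCompl] at h
  obtain ⟨s, hs, h⟩ := h
  exact ⟨s, hs, h⟩

theorem Submodule.pow_smul_mem_pow_smul_top {M : Type*} [AddCommGroup M] [Module R M] {P : Ideal R}
    {a : R} (ha : ∀ m : M, a • m ∈ P • (⊤ : Submodule R M)) (k : ℕ) (m : M) :
    a ^ k • m ∈ P ^ k • (⊤ : Submodule R M) := by
  induction k generalizing m with
  | zero => simp
  | succ k ih =>
    rw [pow_succ a, mul_smul]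
    refine Submodule.smul_induction_on (p := fun x => a ^ k • x ∈ P ^ (k + 1) • (⊤ : Submodule R M))
      (ha m) (fun r hr x _ => ?_) fun x y hx hy => ?_
    · rw [smul_comm, pow_succ', ← smul_eq_mul, Submodule.smul_assoc]
      exact Submodule.smul_mem_smul hr (ih x)
    · rw [smul_add]
      exact Submodule.add_mem _ hx hy

/-- At a minimal prime `P` over `J ∩ R`, the cyclic module `D / J` remains nonzero modulo `P`, even
after inverting the complement of `P`. -/
theorem Ideal.smul_mk_one_notMem_smul_top_of_mem_minimalPrimes [IsNoetherianRing R] {J : Ideal D}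
    {P : Ideal R} (hP : P ∈ (J.comap (algebraMap R D)).minimalPrimes) {a : R} (ha : a ∉ P) :
    a • (Submodule.Quotient.mk 1 : D ⧸ J) ∉ P • (⊤ : Submodule R (D ⧸ J)) := by
  intro hmem
  have hsmul (m : D ⧸ J) : a • m ∈ P • (⊤ : Submodule R (D ⧸ J)) := by
    obtain ⟨d, rfl⟩ := Submodule.Quotient.mk_surjective J m
    -- Left multiplication by `d` is `R`-linear, so it carries the hypothesis from the class of `1`
    -- to that of `d`.
    have h := Submodule.mem_map_of_mem (f := Algebra.lsmul R R (D ⧸ J) d) hmem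
    rw [Submodule.map_smul''] at h
    have h2 := Submodule.smul_mono le_rfl (le_top : _ ≤ (⊤ : Submodule R (D ⧸ J))) h
    rw [Algebra.lsmul_coe] at h2
    beta_reduce at h2
    rwa [smul_comm, ← Submodule.Quotient.mk_smul, smul_eq_mul, mul_one] at h2
  obtain ⟨k, hk⟩ := Ideal.exists_pow_forall_exists_mul_mem_of_mem_minimalPrimes hP
  have hprime := hP.isPrime
  have hkill (x : D ⧸ J) (hx : x ∈ P ^ k • (⊤ : Submodule R (D ⧸ J))) : ∃ s ∉ P, s • x = 0 := by
    refine Submodule.smul_induction_on hx (fun r hr m _ => ?_) fun x y ⟨s, hs, hx⟩ ⟨t, ht, hy⟩ => ?_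
    · obtain ⟨s, hs, hsr⟩ := hk r hr
      rw [← Ideal.annihilator_quotient_eq_comap_algebraMap] at hsr
      exact ⟨s, hs, by rw [← mul_smul]; exact Module.mem_annihilator.1 hsr m⟩
    · exact ⟨s * t, fun h => (hprime.mem_or_mem h).elim hs ht, by
        rw [smul_add, mul_smul s t y, hy, mul_comm, mul_smul, hx, smul_zero, smul_zero, add_zero]⟩
  obtain ⟨s, hs, h0⟩ := hkill _ (Submodule.pow_smul_mem_pow_smul_top hsmul k (Submodule.Quotient.mk 1))
  rw [← mul_smul, ← Submodule.Quotient.mk_smul, Submodule.Quotient.mk_eq_zero,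
    ← Algebra.algebraMap_eq_smul_one] at h0
  exact (hprime.mem_or_mem (hP.1.2 h0)).elim hs fun h => ha (hprime.mem_of_pow_mem k h)

/-- If `D / J` vanishes modulo the ideal `I`, then `1 ∈ J + I D`. -/
theorem Ideal.exists_mem_one_sub_mem_smul_top {J : Ideal D} {I : Ideal R}
    (h : Subsingleton ((D ⧸ J) ⊗[R] (R ⧸ I))) :
    ∃ f ∈ J, 1 - f ∈ I • (⊤ : Submodule R D) := by
  have h' := (TensorProduct.tensorQuotEquivQuotSMul (D ⧸ J) I).symm.toEquiv.subsingleton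
  rw [Submodule.Quotient.subsingleton_iff] at h'
  have h1 : (Submodule.Quotient.mk 1 : D ⧸ J) ∈ I • (⊤ : Submodule R (D ⧸ J)) := by
    rw [h']
    trivial
  have hsurj : Function.Surjective (J.mkQ.restrictScalars R) := Submodule.mkQ_surjective J
  rw [← LinearMap.range_eq_top.2 hsurj, LinearMap.range_eq_map, ← Submodule.map_smul''] at h1
  obtain ⟨g, hg, hg1⟩ := h1
  exact ⟨1 - g, (Submodule.Quotient.eq J).1 hg1.symm, by simpa using hg⟩

/-- Write `1 = r + i`: `r` kills the left factor and `i` the right one. -/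
theorem TensorProduct.subsingleton_of_one_mem_annihilator_sup {M : Type*} [AddCommGroup M]
    [Module R M] {I : Ideal R} (h : 1 ∈ Module.annihilator R M ⊔ I) :
    Subsingleton (M ⊗[R] (R ⧸ I)) := by
  obtain ⟨r, hr, i, hi, hri⟩ := Submodule.mem_sup.1 h
  refine subsingleton_of_forall_eq 0 fun t => ?_
  induction t using TensorProduct.induction_on with
  | zero => rfl
  | add x y hx hy => rw [hx, hy, add_zero]
  | tmul m q =>
    obtain ⟨q, rfl⟩ := Ideal.Quotient.mk_surjective q
    have hq : i • Ideal.Quotient.mk I q = 0 :=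
      Ideal.Quotient.eq_zero_iff_mem.2 (I.mul_mem_right q hi)
    rw [← one_smul R (m ⊗ₜ[R] Ideal.Quotient.mk I q), ← hri, add_smul, TensorProduct.smul_tmul',
      Module.mem_annihilator.1 hr, ← TensorProduct.tmul_smul, hq, TensorProduct.zero_tmul,
      TensorProduct.tmul_zero, add_zero]

end AlgebraQuotient

/-! ### Gluing open subsets of irreducible components -/

section ZeroLocus

open MvPolynomial

variable {k σ : Type*} [Field k] [IsAlgClosed k] [Finite σ]

/-- A union of nonempty basic open subsets, one in each irreducible component of `Z(I)`, contains
a Zariski open and dense subset of `Z(I)`. -/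
theorem MvPolynomial.exists_dense_sdiff_zeroLocus (I : Ideal (MvPolynomial σ k)) (S : Set (σ → k))
    (hS : ∀ P ∈ I.minimalPrimes, ∃ h ∉ P, ∀ α ∈ zeroLocus k P, eval α h ≠ 0 → α ∈ S) :
    ∃ K : Ideal (MvPolynomial σ k), zeroLocus k I \ zeroLocus k K ⊆ S ∧
      ∀ L : Ideal (MvPolynomial σ k), zeroLocus k I \ zeroLocus k K ⊆ zeroLocus k L →
        zeroLocus k I ⊆ zeroLocus k L := by
  classical
  choose! h hP hhS using hS
  have hfin := I.finite_minimalPrimes_of_isNoetherianRing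
  -- `g` vanishes on every other component, so `h P * g P ≠ 0` cuts out an open piece of `Z(P)`
  -- alone.
  have exists_sep (P) (hPI : P ∈ I.minimalPrimes) :
      ∃ g ∉ P, ∀ Q ∈ I.minimalPrimes, Q ≠ P → g ∈ Q := by
    have hnot : ¬ (hfin.toFinset.erase P).inf id ≤ P := by
      rw [hPI.isPrime.inf_le']
      rintro ⟨Q, hQ, hle⟩
      rw [Finset.mem_erase, hfin.mem_toFinset] at hQ
      exact hQ.1 (le_antisymm hle (hPI.2 hQ.2.1 hle))
    obtain ⟨g, hg, hgP⟩ := SetLike.not_le_iff_exists.1 hnot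
    refine ⟨g, hgP, fun Q hQ hne => ?_⟩
    exact Finset.inf_le (f := id) (Finset.mem_erase.2 ⟨hne, hfin.mem_toFinset.2 hQ⟩) hg
  choose! g hgP hgQ using exists_sep
  have exists_prime (α : σ → k) (hα : α ∈ zeroLocus k I) :
      ∃ P ∈ I.minimalPrimes, α ∈ zeroLocus k P := by
    have := RingHom.ker_isPrime (eval α : MvPolynomial σ k →+* k)
    obtain ⟨P, hPI, hle⟩ := Ideal.exists_minimalPrimes_le
      (I := I) (J := RingHom.ker (eval α)) fun f hf => by simpa using hα f hf
    exact ⟨P, hPI, fun f hf => by simpa using hle hf⟩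
  refine ⟨Ideal.span ((fun P => h P * g P) '' I.minimalPrimes), ?_, fun L hL => ?_⟩
  · rintro α ⟨hα, hαK⟩
    obtain ⟨Q, hQ, hαQ⟩ := exists_prime α hα
    rw [zeroLocus_span] at hαK
    simp only [Set.mem_ofPred_eq, Set.forall_mem_image, not_forall] at hαK
    obtain ⟨P, hPI, hne⟩ := hαK
    rw [map_mul, mul_eq_zero, not_or] at hne
    obtain rfl : Q = P := by
      by_contra hQP
      exact hne.2 (hαQ _ (hgQ P hPI Q hQ hQP))
    exact hhS Q hQ α hαQ (by simpa using hne.1)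
  · intro α hα f hf
    obtain ⟨P, hPI, hαP⟩ := exists_prime α hα
    have hprime := hPI.isPrime
    refine hαP f ?_
    -- The product vanishes on all of `Z(P)`, so the Nullstellensatz applies; primality then gives
    -- `f ∈ P`.
    have hmem : f * (h P * g P) ∈ P := by
      have hvan := MvPolynomial.IsPrime.vanishingIdeal_zeroLocus (k := k) (K := k) P
      refine hvan.le fun β hβ => ?_
      rw [map_mul, mul_eq_zero]
      by_cases hne : aeval β (h P * g P) = 0
      · exact Or.inr hne
      · refine Or.inl (hL ⟨zeroLocus_anti_mono hPI.1.2 hβ, fun hβK => hne ?_⟩ f hf)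
        exact hβK _ (Ideal.subset_span ⟨P, hPI, rfl⟩)
    refine (hprime.mem_or_mem hmem).resolve_right fun h' => ?_
    exact (hprime.mem_or_mem h').elim (hP P hPI) (hgP P hPI)

end ZeroLocus

/-! ### Specializing left ideals of the relative Weyl algebra -/

noncomputable section

namespace RelWeylAlgebra

open MonomialOrder

variable {n p : ℕ}

/-- The basis of `D_n[s]` over `ℂ[s]` consisting of the normally ordered monomials. -/
def normalBasis (n p : ℕ) :
    Module.Basis (Fin n ⊕ Fin n →₀ ℕ) (ParamRing p) (RelWeylAlgebra n p) :=
  (WeylAlgebra.normalBasis n).baseChange (ParamRing p)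

theorem normalBasis_apply (γ : Fin n ⊕ Fin n →₀ ℕ) :
    normalBasis n p γ = (1 ⊗ₜ WeylAlgebra.normalBasis n γ : ParamRing p ⊗[ℂ] WeylAlgebra n) :=
  Module.Basis.baseChange_apply _ _ _

theorem normalBasis_zero : normalBasis n p 0 = 1 := by
  rw [normalBasis_apply, WeylAlgebra.normalBasis_zero]
  rfl

theorem exists_mul_normalBasis (j : Fin n ⊕ Fin n) : ∃ w : RelWeylAlgebra n p, ∀ γ, ∃ γ' ≤ γ,
    ∃ c : ParamRing p,
      w * normalBasis n p γ =
        normalBasis n p (Finsupp.single j 1 + γ) + c • normalBasis n p γ' := by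
  obtain ⟨w, hw⟩ := WeylAlgebra.exists_mul_normalBasis j
  refine ⟨(1 ⊗ₜ w : ParamRing p ⊗[ℂ] WeylAlgebra n), fun γ => ?_⟩
  obtain ⟨γ', hγ', c, h⟩ := hw γ
  refine ⟨γ', hγ', MvPolynomial.C c, ?_⟩
  rw [normalBasis_apply, normalBasis_apply, normalBasis_apply]
  refine (Algebra.TensorProduct.tmul_mul_tmul _ _ _ _).trans ?_
  rw [h, TensorProduct.tmul_add, one_mul, ← TensorProduct.smul_tmul, MvPolynomial.smul_eq_C_mul]
  rfl

/-- The coordinate families of the elements of a left ideal. -/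
def coordinates (J : Ideal (RelWeylAlgebra n p)) :
    Submodule (ParamRing p) ((Fin n ⊕ Fin n →₀ ℕ) →₀ ParamRing p) :=
  (J.restrictScalars (ParamRing p)).map (normalBasis n p).repr.toLinearMap

theorem isShiftStableMod_coordinates (m : MonomialOrder (Fin n ⊕ Fin n)) (P : Ideal (ParamRing p))
    (J : Ideal (RelWeylAlgebra n p)) : m.IsShiftStableMod P (coordinates J) := by
  rintro _ ⟨f, hf, rfl⟩ j γ hγ
  obtain ⟨w, hw⟩ := exists_mul_normalBasis (n := n) (p := p) j
  set b := normalBasis n p with hb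
  simp only [LinearEquiv.coe_coe] at hγ ⊢
  have lt_single_add (γ') : m.toSyn γ' < m.toSyn (Finsupp.single j 1 + γ') :=
    m.toSyn_strictMono (lt_add_of_pos_left _ (by simp [pos_iff_ne_zero]))
  have coord_lt (γ' δ) (h : m.toSyn (Finsupp.single j 1 + γ') < m.toSyn δ) :
      b.repr (w * b γ') δ = 0 := by
    obtain ⟨γ'', hle, c, hc⟩ := hw γ'
    have h1 : δ ≠ Finsupp.single j 1 + γ' := fun h' => h.ne' (by rw [h'])
    have h2 : δ ≠ γ'' := fun h' =>
      ((m.toSyn_monotone hle).trans_lt ((lt_single_add γ').trans h)).ne' (by rw [h'])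
    simp [hc, h1.symm, h2.symm]
  have coord_self (γ') : b.repr (w * b γ') (Finsupp.single j 1 + γ') = 1 := by
    obtain ⟨γ'', hle, c, hc⟩ := hw γ'
    have h2 : Finsupp.single j 1 + γ' ≠ γ'' := fun h' =>
      ((m.toSyn_monotone hle).trans_lt (lt_single_add γ')).ne' (by rw [h'])
    simp [hc, h2.symm]
  have coord_mem (g : RelWeylAlgebra n p) (δ)
      (h : ∀ γ', b.repr g γ' ∈ P ∨ b.repr (w * b γ') δ = 0) : b.repr (w * g) δ ∈ P := by
    rw [show w * g = w * Finsupp.linearCombination _ b (b.repr g) by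
      rw [b.linearCombination_repr], Finsupp.linearCombination_apply, Finsupp.sum, Finset.mul_sum, map_sum,
      Finsupp.finsetSum_apply]
    refine P.sum_mem fun γ' _ => ?_
    rw [mul_smul_comm, map_smul, Finsupp.smul_apply, smul_eq_mul]
    rcases h γ' with h | h
    · exact P.mul_mem_right _ h
    · rw [h, mul_zero]
      exact P.zero_mem
  refine ⟨b.repr (w * f), ⟨w * f, J.smul_mem w hf, rfl⟩, ?_, fun δ hδ => ?_⟩
  -- After removing the term at `γ`, coefficients at larger exponents lie in `P`, and smaller
  -- exponents cannot reach `single j 1 + γ`.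
  · have h := coord_mem (f - b.repr f γ • b γ) (Finsupp.single j 1 + γ) fun γ' => ?_
    · rwa [mul_sub, mul_smul_comm, map_sub, map_smul, Finsupp.sub_apply, Finsupp.smul_apply,
        coord_self, smul_eq_mul, mul_one] at h
    · rcases lt_trichotomy (m.toSyn γ') (m.toSyn γ) with hlt | heq | hlt
      · exact Or.inr (coord_lt _ _ (by simpa using hlt))
      · obtain rfl := m.toSyn.injective heq
        exact Or.inl (by simp)
      · have hne : γ ≠ γ' := fun h' => hlt.ne (by rw [h'])
        exact Or.inl (by simpa [Finsupp.single_apply, hne] using hγ γ' hlt)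
  · refine coord_mem f δ fun γ' => ?_
    rcases lt_or_ge (m.toSyn γ) (m.toSyn γ') with hlt | hle
    · exact Or.inl (hγ γ' hlt)
    · exact Or.inr (coord_lt _ _ (lt_of_le_of_lt (by simpa using hle) hδ))

theorem repr_mem_of_mem_smul_top {I : Ideal (ParamRing p)} {f : RelWeylAlgebra n p}
    (hf : f ∈ I • (⊤ : Submodule (ParamRing p) (RelWeylAlgebra n p))) (γ : Fin n ⊕ Fin n →₀ ℕ) :
    (normalBasis n p).repr f γ ∈ I := by
  refine Submodule.smul_induction_on hf (fun r hr g _ => ?_) fun x y hx hy => ?_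
  · rw [map_smul, Finsupp.smul_apply, smul_eq_mul]
    exact I.mul_mem_right _ hr
  · rw [map_add, Finsupp.add_apply]
    exact I.add_mem hx hy

theorem mem_smul_top_of_repr_mem {I : Ideal (ParamRing p)} {f : RelWeylAlgebra n p}
    (hf : ∀ γ, (normalBasis n p).repr f γ ∈ I) :
    f ∈ I • (⊤ : Submodule (ParamRing p) (RelWeylAlgebra n p)) := by
  rw [← (normalBasis n p).linearCombination_repr f, Finsupp.linearCombination_apply]
  exact Submodule.sum_mem _ fun γ _ => Submodule.smul_mem_smul (hf γ) trivial

/-- The specialization of `D_n[s] / J` is nonzero at a general point of each irreducible component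
of the zero locus of `J ∩ ℂ[s]`. -/
theorem exists_nontrivial_specializationAt {J : Ideal (RelWeylAlgebra n p)} {P : Ideal (ParamRing p)}
    (hP : P ∈ (J.comap (algebraMap (ParamRing p) (RelWeylAlgebra n p))).minimalPrimes) :
    ∃ h ∉ P, ∀ α ∈ MvPolynomial.zeroLocus ℂ P, MvPolynomial.eval α h ≠ 0 →
      Nontrivial (SpecializationAt J α) := by
  obtain ⟨m⟩ := MonomialOrder.nonempty_of_finite (Fin n ⊕ Fin n)
  obtain ⟨h, hhP, hh⟩ := (isShiftStableMod_coordinates m P J).exists_specialization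
    hP.isPrime
  refine ⟨h, hhP, fun α hα hne => ?_⟩
  by_contra hsub
  obtain ⟨f, hf, hf1⟩ := Ideal.exists_mem_one_sub_mem_smul_top (not_nontrivial_iff_subsingleton.1 hsub)
  have eval_repr (γ) : MvPolynomial.eval α ((normalBasis n p).repr f γ) =
      if γ = 0 then 1 else 0 := by
    have h1 := repr_mem_of_mem_smul_top hf1 γ
    rw [maximalIdealAt, RingHom.mem_ker, ← normalBasis_zero, map_sub, Module.Basis.repr_self,
      Finsupp.sub_apply, map_sub, sub_eq_zero, Finsupp.single_apply] at h1
    rw [← h1]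
    simp only [eq_comm (a := γ), apply_ite (MvPolynomial.eval α), map_one, map_zero]
  rcases hh (MvPolynomial.eval α) (fun a ha => by simpa using hα a ha) hne _ ⟨f, hf, rfl⟩ with h0 | h0
  · have := h0 0
    rw [LinearEquiv.coe_coe, eval_repr, if_pos rfl] at this
    exact one_ne_zero this
  · obtain ⟨γ, ⟨_, ⟨g, hg, rfl⟩, hg0, hlead⟩, hγ⟩ := h0
    rw [LinearEquiv.coe_coe, eval_repr] at hγ
    obtain rfl : γ = 0 := by
      by_contra hne'
      exact hγ (if_neg hne')
    simp only [LinearEquiv.coe_coe] at hg0 hlead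
    refine Ideal.smul_mk_one_notMem_smul_top_of_mem_minimalPrimes hP hg0 ?_
    -- Exponent `0` is the least, so every nonconstant coefficient of `g` lies in `P`.
    have hmem : (normalBasis n p).repr g 0 • 1 - g ∈
        P • (⊤ : Submodule (ParamRing p) (RelWeylAlgebra n p)) := by
      refine mem_smul_top_of_repr_mem fun δ => ?_
      rw [← normalBasis_zero]
      by_cases hδ : δ = 0
      · subst hδ
        simp
      · have := hlead δ (m.toSyn_strictMono (pos_iff_ne_zero.2 hδ))
        simpa [Finsupp.single_apply, Ne.symm hδ] using this
    have hmap := Submodule.mem_map_of_mem (f := J.mkQ.restrictScalars (ParamRing p)) hmem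
    rw [Submodule.map_smul''] at hmap
    have hmap' := Submodule.smul_mono le_rfl
      (le_top : _ ≤ (⊤ : Submodule (ParamRing p) (RelWeylAlgebra n p ⧸ J))) hmap
    have hg' : J.mkQ g = 0 := (Submodule.Quotient.mk_eq_zero J).2 hg
    rw [map_sub, map_smul] at hmap'
    simpa [hg'] using hmap'

/-- The specialization vanishes wherever some element of the annihilator does not. -/
theorem specializationSupport_subset_annihilatorZeroSet (J : Ideal (RelWeylAlgebra n p)) :
    specializationSupport J ⊆ annihilatorZeroSet J := by
  intro α hα r hr
  by_contra hne
  have hα' : Nontrivial (SpecializationAt J α) := hα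
  refine not_subsingleton (SpecializationAt J α)
    (TensorProduct.subsingleton_of_one_mem_annihilator_sup (Submodule.mem_sup.2 ?_))
  rw [MvPolynomial.aeval_eq_eval] at hne
  -- Rescale `r` to take the value `1` at `α`; its difference from `1` then lies in `𝔪_α`.
  refine ⟨MvPolynomial.C (MvPolynomial.eval α r)⁻¹ * r, Ideal.mul_mem_left _ _ hr,
    1 - MvPolynomial.C (MvPolynomial.eval α r)⁻¹ * r, ?_,
    by ring⟩
  rw [maximalIdealAt, RingHom.mem_ker, map_sub, map_mul, MvPolynomial.eval_C, inv_mul_cancel₀ hne,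
    map_one, sub_self]

end RelWeylAlgebra

end

theorem theoremB (n p : ℕ) (J : Ideal (RelWeylAlgebra n p)) :
    (∀ P ∈ (J.comap (algebraMap (ParamRing p) (RelWeylAlgebra n p))).minimalPrimes,
      ∃ h : ParamRing p, h ∉ P ∧
        ∀ α ∈ MvPolynomial.zeroLocus ℂ P, MvPolynomial.eval α h ≠ 0 →
          Nontrivial (SpecializationAt J α)) ∧
    specializationSupport J ⊆ annihilatorZeroSet J ∧
    ∃ U ⊆ specializationSupport J,
      IsZariskiOpenIn U (annihilatorZeroSet J) ∧ IsZariskiDenseIn U (annihilatorZeroSet J) := by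
  refine ⟨fun P hP => RelWeylAlgebra.exists_nontrivial_specializationAt hP,
    RelWeylAlgebra.specializationSupport_subset_annihilatorZeroSet J, ?_⟩
  obtain ⟨K, hKS, hK⟩ := MvPolynomial.exists_dense_sdiff_zeroLocus
    (Module.annihilator (ParamRing p) (RelWeylAlgebra n p ⧸ J)) (specializationSupport J) (by
      rw [Ideal.annihilator_quotient_eq_comap_algebraMap]
      exact fun P hP => RelWeylAlgebra.exists_nontrivial_specializationAt hP)
  exact ⟨annihilatorZeroSet J \ MvPolynomial.zeroLocus ℂ K, hKS, ⟨K, rfl⟩, Set.sdiff_subset, hK⟩
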